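/- Let $p>2$. For $\ell_1,\ell_2>0$ let $G=G_{\ell_1,\ell_2}$ be the metric graph with three edges meeting at one vertex, the origin: a half-line $e_0\cong[0,\infty)$ and two bounded edges $e_1\cong[0,\ell_1]$, $e_2\cong[0,\ell_2]$, each parametrized by the distance to the origin (which corresponds to $0$). A function $v$ on $G$ is a triple $(v_0,v_1,v_2)$ of functions $v_i\colon e_i\to\mathbb R$ with $v_0(0)=v_1(0)=v_2(0)$. It belongs to $H^1_0(G)$ if every $v_i$ is continuous on $e_i$ and of class $H^1$ on its interior, and $v_1(\ell_1)=v_2(\ell_2)=0$. It is a solution of the Kirkhoff--ODE system in $G$ if $v\in H^1_0(G)$, each $v_i$ is of class $C^2$ in the interior of $e_i$ and satisfies there $$-v_i''+v_i=|v_i|^{p-2}v_i ,$$ and the outward derivatives at the origin (the one-sided derivatives of the $v_i$ at $0$) exist and satisfy $v_0'(0+)+v_1'(0+)+v_2'(0+)=0$. Then there are constants $a>0$ and $L>0$, depending only on $p$, such that for all $0<\ell_1<a$ and all $\ell_2>L$ the Kirkhoff--ODE system in $G_{\ell_1,\ell_2}$ has at least two distinct solutions that are nonnegative and not identically zero. 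-/

import Mathlib

open MeasureTheory
open scoped ENNReal ContDiff

/-- A metric graph whose edges, indexed by `ι` (at least two of them), all meet at one inner vertex,
the origin, and are otherwise disjoint. Each edge has a length in `(0, ∞]`; an edge of length `∞` is a
half-line. The outer vertices are the far endpoints of the bounded edges. -/
structure StarMetricGraph (ι : Type*) where
  length : ι → ℝ≥0∞
  length_pos : ∀ i, 0 < length i
  nontrivial_edges : Nontrivial ι

namespace StarMetricGraph

variable {ι : Type*} (G : StarMetricGraph ι)

/-- The closed edge `i`, parametrized by the distance to the origin: `[0, length i]`,
or `[0, ∞)` for a half-line. -/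
def edge (i : ι) : Set ℝ := {x | 0 ≤ x ∧ ENNReal.ofReal x ≤ G.length i}

/-- The open edge `i`, that is `(0, length i)`. -/
def openEdge (i : ι) : Set ℝ := {x | 0 < x ∧ ENNReal.ofReal x < G.length i}

/-- `g` is a weak derivative of `f` in the open set `U ⊆ ℝ`. -/
def IsWeakDeriv (U : Set ℝ) (f g : ℝ → ℝ) : Prop :=
  ∀ φ : ℝ → ℝ, ContDiff ℝ ∞ φ → HasCompactSupport φ → tsupport φ ⊆ U →
    ∫ x in U, f x * deriv φ x = - ∫ x in U, g x * φ x

/-- Membership in the Sobolev space `H¹(U)`, for an open set `U ⊆ ℝ`. -/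
def MemH1 (U : Set ℝ) (f : ℝ → ℝ) : Prop :=
  MemLp f 2 (volume.restrict U) ∧
    ∃ g : ℝ → ℝ, MemLp g 2 (volume.restrict U) ∧ IsWeakDeriv U f g

/-- A function on the graph is given by its restrictions `v i` to the edges, of which only the values
on `G.edge i` matter. It belongs to `H¹₀(G)` if it is continuous on `G` (on each closed edge, with
one common value at the origin), is of class `H¹` on each edge, and vanishes at the outer vertices.
For finitely many edges the sum of the squared `H¹` norms is then finite. -/
structure MemH10 [Finite ι] (v : ι → ℝ → ℝ) : Prop where
  continuousOn_edge : ∀ i, ContinuousOn (v i) (G.edge i)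
  agree_origin : ∀ i j, v i 0 = v j 0
  memH1 : ∀ i, MemH1 (G.openEdge i) (v i)
  dirichlet : ∀ i (b : ℝ), 0 < b → G.length i = ENNReal.ofReal b → v i b = 0

/-- The equation `-v'' + v = |v|^(p-2) v` inside every edge, for `v` of class `C²` there. -/
def SolvesODE (p : ℝ) (v : ι → ℝ → ℝ) : Prop :=
  ∀ i, ContDiffOn ℝ 2 (v i) (G.openEdge i) ∧
    ∀ x ∈ G.openEdge i, - deriv (deriv (v i)) x + v i x = |v i x| ^ (p - 2) * v i x

/-- The Kirkhoff condition at the origin: the outward derivatives along the edges exist and their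
sum is zero. -/
def Kirkhoff [Fintype ι] (v : ι → ℝ → ℝ) : Prop :=
  ∃ d : ι → ℝ, (∀ i, HasDerivWithinAt (v i) (d i) (G.edge i) 0) ∧ ∑ i, d i = 0

/-- Solutions of the Kirkhoff–ODE system in `G`. -/
structure IsKirkhoffODESolution [Fintype ι] (p : ℝ) (v : ι → ℝ → ℝ) : Prop where
  memH10 : G.MemH10 v
  ode : G.SolvesODE p v
  kirkhoff : G.Kirkhoff v

/-- `v ≥ 0` everywhere on `G`. -/
def Nonneg (v : ι → ℝ → ℝ) : Prop := ∀ i, ∀ x ∈ G.edge i, 0 ≤ v i x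

/-- `v` and `w` are the same function on `G`. -/
def SameFun (v w : ι → ℝ → ℝ) : Prop := ∀ i, ∀ x ∈ G.edge i, v i x = w i x

/-- Three edges meeting at the origin: a half-line (edge `0`) and two bounded edges, of lengths
`ℓ₁` (edge `1`) and `ℓ₂` (edge `2`). -/
noncomputable def halfLineTwoBounded (ℓ₁ ℓ₂ : ℝ) (h₁ : 0 < ℓ₁) (h₂ : 0 < ℓ₂) :
    StarMetricGraph (Fin 3) where
  length := ![∞, ENNReal.ofReal ℓ₁, ENNReal.ofReal ℓ₂]
  length_pos := by
    intro i
    fin_cases i <;> simp [h₁, h₂]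
  nontrivial_edges := inferInstance

end StarMetricGraph

/-! The proof is a shooting argument in the phase plane of $u''=u-|u|^{p-2}u$, with parameter
$m\in(0,1]$, the slope at the outer vertex of the short edge. Crossing that edge, the orbit of
$(0,m)$ reaches the origin with value $t\approx m\ell_1$ and velocity $s\approx m$. On the half-line
the solution is a piece of soliton with value $t$ and slope $\sigma q$, where $\sigma=\pm1$ and
$(t,\pm q)$ has zero energy (`exists_soliton`). The Kirkhoff condition then forces the data
$(t,s-\sigma q)$ on the long edge, and it remains to choose $m$ so that this orbit first vanishes at
time $\ell_2$.

For small $m$ the orbit stays positive on $[0,\ell_2]$ (`position_pos_of_small`). For $m=1$ it is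
close to the orbit of $(0,1)$, which becomes negative at a time $L<\ell_2$ (`exists_position_neg`).
By continuity the minimum over $[0,\ell_2]$ vanishes for some $m$. Since $q\le t$ is small against
$s$, the energy $s(s-2\sigma q)/2$ is positive (`exists_longEdgeData_bounds`), so an interior double
zero is impossible and the zero sits at $\ell_2$ (`exists_shooting`). The two signs of $\sigma$ give
opposite slopes on the half-line, hence distinct solutions. -/

/-! ### Global flows of bounded Lipschitz fields -/

section Flow

variable {E : Type*} [NormedAddCommGroup E] [NormedSpace ℝ E]

/-- A bounded Lipschitz vector field on a Banach space has a global flow. -/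
theorem LipschitzWith.exists_global_flow [CompleteSpace E] {F : E → E} {K C : NNReal}
    (hF : LipschitzWith K F) (hC : ∀ z, ‖F z‖ ≤ C) :
    ∃ Φ : E → ℝ → E, (∀ z, Φ z 0 = z) ∧ ∀ z t, HasDerivAt (Φ z) (F (Φ z t)) t := by
  suffices H : ∀ z, ∃ Φ : ℝ → E, Φ 0 = z ∧ ∀ t, HasDerivAt Φ (F (Φ t)) t by
    choose Φ h₀ h₁ using H
    exact ⟨Φ, h₀, h₁⟩
  intro z
  have loc : ∀ n : ℕ, ∃ α : ℝ → E, α 0 = z ∧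
      ∀ t ∈ Set.Ioo (-((n : ℝ) + 1)) (n + 1), HasDerivAt α (F (α t)) t := by
    intro n
    have hn : (0 : ℝ) ≤ n := n.cast_nonneg
    -- The global bound `C` confines the solution to radius `C * (n + 1)`, so a single
    -- Picard–Lindelöf step covers the whole time interval.
    have hpl : IsPicardLindelof (fun _ => F) (tmin := -((n : ℝ) + 1)) (tmax := n + 1)
        ⟨0, by constructor <;> linarith⟩ z (C * (n + 1)) 0 C K :=
      { lipschitzOnWith := fun _ _ => hF.lipschitzOnWith
        continuousOn := fun _ _ => continuousOn_const
        norm_le := fun _ _ x _ => hC x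
        mul_max_le := by simp }
    obtain ⟨α, h0, h1⟩ := hpl.exists_eq_forall_mem_Icc_hasDerivWithinAt₀
    exact ⟨α, h0, fun t ht => (h1 t ⟨ht.1.le, ht.2.le⟩).hasDerivAt (Icc_mem_nhds ht.1 ht.2)⟩
  choose α h0 h1 using loc
  have key : ∀ (n k : ℕ) (s : ℝ), |s| < n + 1 → |s| < k + 1 → α n s = α k s := by
    intro n k s hn hk
    have hr : |s| < min ((n : ℝ) + 1) (k + 1) := lt_min hn hk
    have hr0 : 0 < min ((n : ℝ) + 1) (k + 1) := lt_of_le_of_lt (abs_nonneg s) hr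
    have := ODE_solution_unique_of_mem_Ioo (v := fun _ => F) (s := fun _ => Set.univ) (K := K)
      (a := -(min ((n : ℝ) + 1) (k + 1))) (b := min ((n : ℝ) + 1) (k + 1)) (t₀ := 0)
      (f := α n) (g := α k)
      (fun _ _ => hF.lipschitzOnWith) ⟨by linarith, hr0⟩
      (fun t ht => ⟨h1 n t ⟨by linarith [ht.1, min_le_left ((n : ℝ) + 1) (k + 1)],
        ht.2.trans_le (min_le_left _ _)⟩, trivial⟩)
      (fun t ht => ⟨h1 k t ⟨by linarith [ht.1, min_le_right ((n : ℝ) + 1) (k + 1)],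
        ht.2.trans_le (min_le_right _ _)⟩, trivial⟩)
      (by rw [h0, h0])
    exact this (abs_lt.1 hr)
  -- The index `⌈|t|⌉₊` puts `t` strictly inside the open interval of its solution, so near `t` the
  -- glued curve agrees with that one solution.
  refine ⟨fun t => α ⌈|t|⌉₊ t, h0 _, fun t => ?_⟩
  have hlt : ∀ s : ℝ, |s| < ⌈|s|⌉₊ + 1 := fun s => by linarith [Nat.le_ceil |s|]
  refine (h1 ⌈|t|⌉₊ t (abs_lt.1 (hlt t))).congr_of_eventuallyEq ?_
  filter_upwards [(continuous_abs.tendsto t).eventually (gt_mem_nhds (hlt t))] with s hs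
  exact key _ _ _ (hlt s) hs

theorem LipschitzWith.dist_integralCurve_le {F : E → E} {K : NNReal} (hF : LipschitzWith K F)
    {f g : ℝ → E} (hf : ∀ t, HasDerivAt f (F (f t)) t) (hg : ∀ t, HasDerivAt g (F (g t)) t)
    {t : ℝ} (ht : 0 ≤ t) : dist (f t) (g t) ≤ dist (f 0) (g 0) * Real.exp (K * t) := by
  have := dist_le_of_trajectories_ODE (v := fun _ => F) (a := 0) (b := t) (fun _ => hF)
    (fun s _ => (hf s).continuousAt.continuousWithinAt) (fun s _ => (hf s).hasDerivWithinAt)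
    (fun s _ => (hg s).continuousAt.continuousWithinAt) (fun s _ => (hg s).hasDerivWithinAt)
    le_rfl t ⟨ht, le_rfl⟩
  simpa using this

/-- Grönwall controls the change of initial point, and continuity of one fixed orbit the change of
time. Times are cut off at `0` because the Grönwall estimate is used forward only. -/
theorem LipschitzWith.continuous_flow_max {F : E → E} {K : NNReal} (hF : LipschitzWith K F)
    {Φ : E → ℝ → E} (h0 : ∀ z, Φ z 0 = z) (hΦ : ∀ z t, HasDerivAt (Φ z) (F (Φ z t)) t) :
    Continuous fun q : E × ℝ => Φ q.1 (max q.2 0) := by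
  rw [continuous_iff_continuousAt]
  rintro ⟨z, t⟩
  have hc : Continuous (Φ z) := continuous_iff_continuousAt.2 fun s => (hΦ z s).continuousAt
  have h1 : Filter.Tendsto (fun q : E × ℝ => dist q.1 z * Real.exp (K * max q.2 0) +
      dist (Φ z (max q.2 0)) (Φ z (max t 0))) (nhds (z, t)) (nhds 0) := by
    have : Continuous fun q : E × ℝ => dist q.1 z * Real.exp (K * max q.2 0) +
      dist (Φ z (max q.2 0)) (Φ z (max t 0)) := by fun_prop
    simpa using this.tendsto (z, t)
  refine tendsto_iff_dist_tendsto_zero.2 (squeeze_zero (fun _ => dist_nonneg) (fun q => ?_) h1)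
  refine (dist_triangle _ (Φ z (max q.2 0)) _).trans (add_le_add ?_ le_rfl)
  simpa [h0] using hF.dist_integralCurve_le (hΦ q.1) (hΦ z) (le_max_right q.2 0)

end Flow

/-! ### Truncated field and energy confinement -/

section PhasePlane

theorem HasDerivAt.component_fst {z : ℝ → ℝ × ℝ} {z' : ℝ × ℝ} {x : ℝ} (h : HasDerivAt z z' x) :
    HasDerivAt (fun y => (z y).1) z'.1 x := by
  simpa [HasDerivAt] using HasFDerivAt.hasDerivAt h.fst

theorem HasDerivAt.component_snd {z : ℝ → ℝ × ℝ} {z' : ℝ × ℝ} {x : ℝ} (h : HasDerivAt z z' x) :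
    HasDerivAt (fun y => (z y).2) z'.2 x := by
  simpa [HasDerivAt] using HasFDerivAt.hasDerivAt h.snd

/-- The phase-plane vector field of `u'' = u - |u|^(p-2) u`. -/
noncomputable def nlsField (p : ℝ) (z : ℝ × ℝ) : ℝ × ℝ := (z.2, z.1 - |z.1| ^ (p - 2) * z.1)

/-- The conserved energy of `u'' = u - |u|^(p-2) u`. -/
noncomputable def nlsEnergy (p : ℝ) (z : ℝ × ℝ) : ℝ := z.2 ^ 2 / 2 - z.1 ^ 2 / 2 + |z.1| ^ p / p

/-- The projection of `ℝ` onto `[-R, R]`. -/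
def clampAbs (R u : ℝ) : ℝ := max (-R) (min R u)

theorem clampAbs_of_abs_le {R u : ℝ} (h : |u| ≤ R) : clampAbs R u = u := by
  rw [clampAbs, min_eq_right (abs_le.1 h).2, max_eq_right (abs_le.1 h).1]

theorem abs_clampAbs_le {R : ℝ} (hR : 0 ≤ R) (u : ℝ) : |clampAbs R u| ≤ R :=
  abs_le.2 ⟨le_max_left _ _, max_le (by linarith) (min_le_left _ _)⟩

theorem lipschitzWith_clampAbs (R : ℝ) : LipschitzWith 1 (clampAbs R) :=
  (LipschitzWith.id.const_min R).const_max (-R)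

theorem lipschitzWith_rpow_projIcc {q R : ℝ} (hq : 1 ≤ q) (hR : 0 ≤ R) :
    ∃ K, LipschitzWith K fun u : ℝ => (max 0 (min R u)) ^ q := by
  have h1 : LipschitzOnWith (q * R ^ (q - 1)).toNNReal (fun x : ℝ => x ^ q) (Set.Icc 0 R) := by
    refine (convex_Icc 0 R).lipschitzOnWith_of_nnnorm_hasDerivWithin_le
      (fun x _ => (Real.hasDerivAt_rpow_const (Or.inr hq)).hasDerivWithinAt) fun x hx => ?_
    rw [← NNReal.coe_le_coe, coe_nnnorm, Real.coe_toNNReal _ (by positivity), Real.norm_eq_abs,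
      abs_of_nonneg (mul_nonneg (by linarith) (Real.rpow_nonneg hx.1 _))]
    have : 0 ≤ q - 1 := by linarith
    gcongr
    · exact hx.1
    · exact hx.2
  have h2 : LipschitzWith 1 fun u : ℝ => max 0 (min R u) :=
    (LipschitzWith.id.const_min R).const_max 0
  refine ⟨_, lipschitzOnWith_univ.1 (h1.comp (h2.lipschitzOnWith (s := Set.univ)) ?_)⟩
  exact fun u _ => ⟨le_max_left _ _, max_le hR (min_le_left _ _)⟩

/-- Splitting into positive and negative parts leaves powers with exponent `p - 1 > 1` on `[0, R]`,
which are Lipschitz. -/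
theorem abs_clampAbs_rpow_mul {p R : ℝ} (hp : 2 < p) (hR : 0 ≤ R) (u : ℝ) :
    |clampAbs R u| ^ (p - 2) * clampAbs R u =
      (max 0 (min R u)) ^ (p - 1) - (max 0 (min R (-u))) ^ (p - 1) := by
  have hp1 : p - 1 ≠ 0 := by linarith
  have key : ∀ x : ℝ, 0 ≤ x → x ^ (p - 2) * x = x ^ (p - 1) := by
    intro x hx
    rw [← Real.rpow_add_one' hx (by linarith)]
    congr 1; ring
  rcases le_total 0 u with h | h
  · have h1 : clampAbs R u = min R u :=
      max_eq_right ((neg_nonpos.2 hR).trans (le_min hR h))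
    have h2 : 0 ≤ min R u := le_min hR h
    rw [h1, abs_of_nonneg h2, key _ h2, max_eq_right h2,
      max_eq_left ((min_le_right _ _).trans (by linarith)), Real.zero_rpow hp1, sub_zero]
  · have h2 : 0 ≤ min R (-u) := le_min hR (by linarith)
    have h1 : clampAbs R u = -min R (-u) := by
      rw [clampAbs, min_eq_right (by linarith : u ≤ R), ← max_neg_neg, neg_neg]
    rw [h1, abs_neg, abs_of_nonneg h2, mul_neg, key _ h2, max_eq_right h2,
      max_eq_left ((min_le_right _ _).trans h), Real.zero_rpow hp1, zero_sub]

/-- The phase-plane field precomposed with the projection onto `[-R, R]²`. -/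
noncomputable def truncNlsField (p R : ℝ) (z : ℝ × ℝ) : ℝ × ℝ :=
  nlsField p (clampAbs R z.1, clampAbs R z.2)

theorem truncNlsField_eq {p R : ℝ} {z : ℝ × ℝ} (hz : ‖z‖ ≤ R) :
    truncNlsField p R z = nlsField p z := by
  have h1 : |z.1| ≤ R := (norm_fst_le z).trans hz
  have h2 : |z.2| ≤ R := (norm_snd_le z).trans hz
  rw [truncNlsField, clampAbs_of_abs_le h1, clampAbs_of_abs_le h2]

theorem lipschitzWith_truncNlsField {p R : ℝ} (hp : 2 < p) (hR : 0 ≤ R) :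
    ∃ K, LipschitzWith K (truncNlsField p R) := by
  obtain ⟨K, hK⟩ := lipschitzWith_rpow_projIcc (q := p - 1) (by linarith) hR
  have h1 : LipschitzWith _ fun z : ℝ × ℝ => clampAbs R z.2 :=
    (lipschitzWith_clampAbs R).comp LipschitzWith.prod_snd
  have h2 : LipschitzWith _ fun z : ℝ × ℝ => clampAbs R z.1 :=
    (lipschitzWith_clampAbs R).comp LipschitzWith.prod_fst
  have h3 := hK.comp LipschitzWith.prod_fst (α := ℝ × ℝ)
  have h4 := hK.comp (LipschitzWith.prod_fst (α := ℝ) (β := ℝ)).neg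
  have h5 := h1.prodMk (h2.sub (h3.sub h4))
  refine ⟨max (1 * 1) (1 * 1 + (K * 1 + K * 1)), fun z z' => ?_⟩
  · simp only [truncNlsField, nlsField, abs_clampAbs_rpow_mul hp hR]
    exact h5 z z'

theorem norm_truncNlsField_le {p R : ℝ} (hp : 2 < p) (hR : 0 ≤ R) (z : ℝ × ℝ) :
    ‖truncNlsField p R z‖ ≤ R + R ^ (p - 2) * R := by
  have hRR : 0 ≤ R ^ (p - 2) * R := by positivity
  have h1 := abs_clampAbs_le hR z.1
  have h2 := abs_clampAbs_le hR z.2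
  refine norm_prod_le_iff.2 ⟨?_, ?_⟩
  · exact h2.trans (by linarith)
  · refine (norm_sub_le _ _).trans (add_le_add h1 ?_)
    rw [norm_mul, Real.norm_eq_abs, Real.norm_eq_abs,
      abs_of_nonneg (Real.rpow_nonneg (abs_nonneg _) _)]
    have : (0:ℝ) ≤ p - 2 := by linarith
    gcongr

theorem abs_rpow_eq {p : ℝ} (hp : 2 < p) (u : ℝ) : |u| ^ p = |u| ^ (p - 2) * u ^ 2 := by
  rw [← sq_abs, ← Real.rpow_natCast, ← Real.rpow_add' (abs_nonneg u)]
  · congr 1; push_cast; ring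
  · push_cast; linarith

/-- A lower bound for the energy in terms of the velocity. -/
theorem sq_div_two_sub_le_nlsEnergy {p : ℝ} (hp : 2 < p) (z : ℝ × ℝ) :
    z.2 ^ 2 / 2 - 1 / 2 ≤ nlsEnergy p z := by
  -- Bernoulli's inequality for $(u^2)^{p/2}$ at $u^2=1$ gives $|u|^p/p-u^2/2\ge 1/p-1/2$.
  have h := one_add_mul_self_le_rpow_one_add (s := z.1 ^ 2 - 1) (p := p / 2)
    (by nlinarith [sq_nonneg z.1]) (by linarith)
  have h2 : (1 + (z.1 ^ 2 - 1)) ^ (p / 2) = |z.1| ^ p := by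
    rw [add_sub_cancel, ← sq_abs, ← Real.rpow_natCast, ← Real.rpow_mul (abs_nonneg _)]
    congr 1; push_cast; ring
  rw [h2] at h
  have h3 : (1 + p / 2 * (z.1 ^ 2 - 1)) / p ≤ |z.1| ^ p / p := by gcongr
  have h4 : (1 + p / 2 * (z.1 ^ 2 - 1)) / p = 1 / p + (z.1 ^ 2 - 1) / 2 := by
    field_simp
  have h5 : 0 < 1 / p := by positivity
  rw [nlsEnergy]; linarith

/-- The norm is the sup norm, so the sphere is the boundary of a square. On the sides $|u|=R$ the
condition on `R` gives $|u|^p/p\ge R^2$; on the sides $|u'|=R$ the kinetic term suffices. Orbits of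
energy at most `2` therefore cannot cross it. -/
theorem lt_nlsEnergy_of_norm_eq {p R : ℝ} (hp : 2 < p) (hR : 3 ≤ R) (hRp : p ≤ R ^ (p - 2))
    {z : ℝ × ℝ} (hz : ‖z‖ = R) : 2 < nlsEnergy p z := by
  rcases max_choice ‖z.1‖ ‖z.2‖ with h | h
  · have h1 : |z.1| = R := by rw [← hz, Prod.norm_def, h, Real.norm_eq_abs]
    have h2 : z.1 ^ 2 = R ^ 2 := by rw [← h1, sq_abs]
    have h3 : R ^ 2 ≤ |z.1| ^ p / p := by
      rw [abs_rpow_eq hp, h1, h2, le_div_iff₀ (by linarith)]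
      nlinarith [sq_nonneg R]
    rw [nlsEnergy, h2]
    nlinarith [sq_nonneg z.2]
  · have h1 : |z.2| = R := by rw [← hz, Prod.norm_def, h, Real.norm_eq_abs]
    have h2 : z.2 ^ 2 = R ^ 2 := by rw [← h1, sq_abs]
    have := sq_div_two_sub_le_nlsEnergy hp z
    nlinarith

theorem hasDerivAt_nlsEnergy {p : ℝ} (hp : 2 < p) {z : ℝ → ℝ × ℝ} {x : ℝ}
    (hz : HasDerivAt z (nlsField p (z x)) x) :
    HasDerivAt (fun y => nlsEnergy p (z y)) 0 x := by
  have h1 : HasDerivAt (fun y => (z y).1) (z x).2 x := hz.component_fst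
  have h2 : HasDerivAt (fun y => (z y).2) ((z x).1 - |(z x).1| ^ (p - 2) * (z x).1) x := hz.component_snd
  have h3 := ((hasDerivAt_abs_rpow (z x).1 (by linarith : 1 < p)).comp x h1).div_const p
  have h4 := (((h2.pow 2).div_const 2).sub ((h1.pow 2).div_const 2)).add h3
  refine HasDerivAt.congr_deriv (f := fun y => nlsEnergy p (z y)) h4 ?_
  field_simp
  ring

/-- A globally defined flow on the plane, generated by a Lipschitz field that agrees with
`nlsField p` on a ball which energy conservation keeps invariant for small energies. -/
structure NlsFlow (p : ℝ) where
  R : ℝ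
  K : NNReal
  F : ℝ × ℝ → ℝ × ℝ
  flow : ℝ × ℝ → ℝ → ℝ × ℝ
  three_le : 3 ≤ R
  le_rpow : p ≤ R ^ (p - 2)
  lipschitz : LipschitzWith K F
  eq_field : ∀ z, ‖z‖ ≤ R → F z = nlsField p z
  flow_zero : ∀ z, flow z 0 = z
  hasDerivAt : ∀ z t, HasDerivAt (flow z) (F (flow z t)) t

theorem nonempty_nlsFlow {p : ℝ} (hp : 2 < p) : Nonempty (NlsFlow p) := by
  have hp2 : 0 < p - 2 := by linarith
  set R : ℝ := max 3 (p ^ (1 / (p - 2)))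
  have hR3 : 3 ≤ R := le_max_left _ _
  have hR : 0 ≤ R := by linarith
  obtain ⟨K, hK⟩ := lipschitzWith_truncNlsField hp hR
  obtain ⟨Φ, h0, h1⟩ := hK.exists_global_flow (C := (R + R ^ (p - 2) * R).toNNReal) fun z =>
    (norm_truncNlsField_le hp hR z).trans (Real.le_coe_toNNReal _)
  refine ⟨⟨R, K, truncNlsField p R, Φ, hR3, ?_, hK, fun _ => truncNlsField_eq, h0, h1⟩⟩
  calc p = (p ^ (1 / (p - 2))) ^ (p - 2) := by
        rw [← Real.rpow_mul (by linarith), one_div_mul_cancel hp2.ne', Real.rpow_one]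
    _ ≤ R ^ (p - 2) := by
        gcongr
        exact le_max_right _ _

namespace NlsFlow

variable {p : ℝ} (S : NlsFlow p)

theorem continuous_flow (z : ℝ × ℝ) : Continuous (S.flow z) :=
  continuous_iff_continuousAt.2 fun t => (S.hasDerivAt z t).continuousAt

theorem F_zero : S.F 0 = 0 := by
  rw [S.eq_field 0 (by simpa using by linarith [S.three_le])]
  simp [nlsField]

/-- Orbits of energy at most `2` starting in the ball stay there, and conserve the energy. -/
theorem invariant (hp : 2 < p) {z : ℝ × ℝ} (hz : ‖z‖ < S.R) (hE : nlsEnergy p z ≤ 2) {t : ℝ}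
    (ht : 0 ≤ t) : ‖S.flow z t‖ < S.R ∧ nlsEnergy p (S.flow z t) = nlsEnergy p z := by
  have hc := S.continuous_flow z
  have cons : ∀ T, 0 ≤ T → (∀ s ∈ Set.Icc 0 T, ‖S.flow z s‖ ≤ S.R) →
      nlsEnergy p (S.flow z T) = nlsEnergy p z := by
    intro T hT h
    have hd : ∀ s ∈ Set.Icc 0 T, HasDerivAt (fun y => nlsEnergy p (S.flow z y)) 0 s := by
      intro s hs
      refine hasDerivAt_nlsEnergy hp ?_
      have := S.hasDerivAt z s
      rwa [S.eq_field _ (h s hs)] at this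
    have := constant_of_has_deriv_right_zero (f := fun y => nlsEnergy p (S.flow z y)) (a := 0)
      (b := T) (fun s hs => (hd s hs).continuousAt.continuousWithinAt)
      (fun s hs => (hd s ⟨hs.1, hs.2.le⟩).hasDerivWithinAt) T ⟨hT, le_rfl⟩
    rwa [S.flow_zero] at this
  have stay : ∀ T, 0 ≤ T → ‖S.flow z T‖ < S.R := by
    intro T hT
    by_contra! hcon
    have hne : (Set.Icc 0 T ∩ {s | S.R ≤ ‖S.flow z s‖}).Nonempty := ⟨T, ⟨hT, le_rfl⟩, hcon⟩
    -- At the first time `s` on or beyond the sphere, energy is still conserved on `[0, s]`, hence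
    -- at most `2`, against the lower bound on the sphere.
    obtain ⟨s, ⟨hs, hsR⟩, hmin⟩ := (isCompact_Icc.inter_right
      (isClosed_le continuous_const hc.norm)).exists_isLeast hne
    have hbefore : ∀ r ∈ Set.Ico 0 s, ‖S.flow z r‖ ≤ S.R := by
      intro r hr
      by_contra! h
      exact absurd (hmin ⟨⟨hr.1, hr.2.le.trans hs.2⟩, h.le⟩) (not_le.2 hr.2)
    have hs0 : s ≠ 0 := by
      rintro rfl
      rw [Set.mem_ofPred_eq, S.flow_zero] at hsR
      linarith
    have hcl : ∀ r ∈ Set.Icc 0 s, ‖S.flow z r‖ ≤ S.R := by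
      rw [← closure_Ico hs0.symm]
      exact closure_minimal hbefore (isClosed_le hc.norm continuous_const)
    have := lt_nlsEnergy_of_norm_eq hp S.three_le S.le_rpow
      (le_antisymm (hcl s ⟨hs.1, le_rfl⟩) hsR)
    rw [cons s hs.1 hcl] at this
    linarith
  exact ⟨stay t ht, cons t ht fun s hs => (stay s hs.1).le⟩

theorem hasDerivAt_of_energy_le (hp : 2 < p) {z : ℝ × ℝ} (hz : ‖z‖ < S.R)
    (hE : nlsEnergy p z ≤ 2) {t : ℝ} (ht : 0 ≤ t) :
    HasDerivAt (S.flow z) (nlsField p (S.flow z t)) t := by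
  have := S.hasDerivAt z t
  rwa [S.eq_field _ (S.invariant hp hz hE ht).1.le] at this

theorem dist_flow_le (z z' : ℝ × ℝ) {t : ℝ} (ht : 0 ≤ t) :
    dist (S.flow z t) (S.flow z' t) ≤ dist z z' * Real.exp (S.K * t) := by
  simpa [S.flow_zero] using S.lipschitz.dist_integralCurve_le (S.hasDerivAt z) (S.hasDerivAt z') ht

theorem norm_flow_le (z : ℝ × ℝ) {t : ℝ} (ht : 0 ≤ t) :
    ‖S.flow z t‖ ≤ ‖z‖ * Real.exp (S.K * t) := by
  have h0 : ∀ t : ℝ, HasDerivAt (fun _ : ℝ => (0 : ℝ × ℝ)) (S.F 0) t := fun t => by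
    rw [S.F_zero]; exact hasDerivAt_const t _
  simpa [S.flow_zero] using S.lipschitz.dist_integralCurve_le (S.hasDerivAt z) h0 ht

theorem continuous_flow_max : Continuous fun q : (ℝ × ℝ) × ℝ => S.flow q.1 (max q.2 0) :=
  S.lipschitz.continuous_flow_max S.flow_zero S.hasDerivAt

end NlsFlow

end PhasePlane

/-! ### Qualitative behaviour of orbits -/

section Shooting

/-- Intermediate value argument for the minimum over a compact interval. -/
theorem exists_nonneg_with_zero {f : ℝ → ℝ → ℝ} (hf : Continuous ↿f) {a b l : ℝ} (hab : a ≤ b)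
    (hl : 0 ≤ l) (ha : ∀ x ∈ Set.Icc 0 l, 0 < f a x) (hb : ∃ x ∈ Set.Icc 0 l, f b x < 0) :
    ∃ m ∈ Set.Icc a b, (∀ x ∈ Set.Icc 0 l, 0 ≤ f m x) ∧ ∃ x ∈ Set.Icc 0 l, f m x = 0 := by
  have hne : (Set.Icc 0 l).Nonempty := ⟨0, le_rfl, hl⟩
  have hmin : ∀ m, ∃ x ∈ Set.Icc 0 l, sInf (f m '' Set.Icc 0 l) = f m x ∧
      ∀ y ∈ Set.Icc 0 l, f m x ≤ f m y := fun m =>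
    isCompact_Icc.exists_sInf_image_eq_and_le hne
      (hf.comp (Continuous.prodMk_right m)).continuousOn
  have hc : Continuous fun m => sInf (f m '' Set.Icc 0 l) := isCompact_Icc.continuous_sInf hf
  have h0 : (0 : ℝ) ∈ Set.Icc (sInf (f b '' Set.Icc 0 l)) (sInf (f a '' Set.Icc 0 l)) := by
    constructor
    · obtain ⟨x, -, hx, hle⟩ := hmin b
      obtain ⟨y, hy, hy0⟩ := hb
      exact hx.trans_le ((hle y hy).trans hy0.le)
    · obtain ⟨x, hx, hx', -⟩ := hmin a
      exact hx' ▸ (ha x hx).le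
  obtain ⟨m, hm, hm0⟩ := intermediate_value_Icc' hab hc.continuousOn h0
  obtain ⟨x, hx, hx', hle⟩ := hmin m
  have hz : f m x = 0 := hx'.symm.trans hm0
  exact ⟨m, hm, fun y hy => hz.symm.trans_le (hle y hy), x, hx, hz⟩

theorem one_sub_rpow_nonneg {p t : ℝ} (hp : 2 < p) (ht : 0 ≤ t) (ht1 : t ≤ 1) :
    0 ≤ 1 - t ^ (p - 2) :=
  sub_nonneg.2 (Real.rpow_le_one ht ht1 (by linarith))

namespace NlsFlow

variable {p : ℝ} (S : NlsFlow p)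

theorem norm_le_iff_abs {z : ℝ × ℝ} {r : ℝ} : ‖z‖ ≤ r ↔ |z.1| ≤ r ∧ |z.2| ≤ r := norm_prod_le_iff

/-- The velocity along the orbit of `(0, 1)` vanishes at some positive time. -/
theorem exists_velocity_eq_zero (hp : 2 < p) : ∃ x, 0 < x ∧ (S.flow (0, 1) x).2 = 0 := by
  have hR := S.three_le
  have hz : ‖((0 : ℝ), (1 : ℝ))‖ < S.R := by simp [Prod.norm_def]; linarith
  have hE1 : nlsEnergy p (0, 1) = 1 / 2 := by
    simp [nlsEnergy, Real.zero_rpow (by linarith : p ≠ 0)]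
  have hE : nlsEnergy p (0, 1) ≤ 2 := by rw [hE1]; norm_num
  have hd := fun x (hx : 0 ≤ x) => S.hasDerivAt_of_energy_le hp hz hE hx
  have hu : ∀ x, 0 ≤ x → HasDerivAt (fun y => (S.flow (0, 1) y).1) (S.flow (0, 1) x).2 x :=
    fun x hx => (hd x hx).component_fst
  have hw : ∀ x, 0 ≤ x → HasDerivAt (fun y => (S.flow (0, 1) y).2)
      ((S.flow (0, 1) x).1 - |(S.flow (0, 1) x).1| ^ (p - 2) * (S.flow (0, 1) x).1) x :=
    fun x hx => (hd x hx).component_snd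
  have hEx := fun x (hx : 0 ≤ x) => (S.invariant hp hz hE hx).2
  have hu0 : (S.flow (0, 1) 0).1 = 0 := by rw [S.flow_zero]
  have hw0 : (S.flow (0, 1) 0).2 = 1 := by rw [S.flow_zero]
  have hcu : Continuous fun y => (S.flow (0, 1) y).1 := (S.continuous_flow _).fst
  have hcw : Continuous fun y => (S.flow (0, 1) y).2 := (S.continuous_flow _).snd
  by_contra! hne
  have hpos : ∀ x, 0 ≤ x → 0 < (S.flow (0, 1) x).2 := by
    intro x hx
    by_contra! hcon
    obtain ⟨y, hy, hy0⟩ := intermediate_value_Icc' hx hcw.continuousOn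
      ⟨hcon, by rw [hw0]; norm_num⟩
    rcases hy.1.eq_or_lt with h | h
    · subst h; simp only [hw0] at hy0; norm_num at hy0
    · exact hne y h hy0
  have hmono : StrictMonoOn (fun y => (S.flow (0, 1) y).1) (Set.Ici 0) := by
    refine strictMonoOn_of_deriv_pos (convex_Ici 0) hcu.continuousOn fun x hx => ?_
    rw [interior_Ici] at hx
    rw [(hu x (le_of_lt hx)).deriv]
    exact hpos x (le_of_lt hx)
  have hnn : ∀ x, 0 ≤ x → 0 ≤ (S.flow (0, 1) x).1 := fun x hx => by
    have := hmono.monotoneOn (Set.mem_Ici.2 le_rfl) hx hx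
    simpa only [hu0] using this
  -- While $0\le u\le1$, the term $u^p/p$ is at most $u^2/2$, so energy $1/2$ forces velocity at
  -- least `1`; the position would then reach `2` by time `2`.
  have h2 : 1 < (S.flow (0, 1) 2).1 := by
    by_contra! hcon
    have hslope : ∀ x ∈ Set.Icc (0 : ℝ) 2, 1 ≤ (S.flow (0, 1) x).2 := by
      intro x hx
      have h0 := hnn x hx.1
      have h1 : (S.flow (0, 1) x).1 ≤ 1 :=
        (hmono.monotoneOn hx.1 (Set.mem_Ici.2 zero_le_two) hx.2).trans hcon
      have he := hEx x hx.1
      have hr := one_sub_rpow_nonneg hp h0 h1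
      rw [hE1, nlsEnergy, abs_rpow_eq hp, abs_of_nonneg h0] at he
      have hle : (S.flow (0, 1) x).1 ^ (p - 2) * (S.flow (0, 1) x).1 ^ 2 / p ≤
          (S.flow (0, 1) x).1 ^ 2 / 2 := by
        rw [div_le_div_iff₀ (by linarith) two_pos]
        nlinarith [sq_nonneg (S.flow (0, 1) x).1, mul_nonneg hr (sq_nonneg (S.flow (0, 1) x).1)]
      nlinarith [hpos x hx.1]
    have := (convex_Icc (0 : ℝ) 2).mul_sub_le_image_sub_of_le_deriv
      (f := fun y => (S.flow (0, 1) y).1) hcu.continuousOn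
      (fun x hx => (hu x (interior_subset hx).1).differentiableAt.differentiableWithinAt)
      (C := 1) (fun x hx => by
        rw [(hu x (interior_subset hx).1).deriv]; exact hslope x (interior_subset hx))
      0 ⟨le_rfl, zero_le_two⟩ 2 ⟨zero_le_two, le_rfl⟩ zero_le_two
    simp only [hu0] at this
    linarith
  have hk : 0 < (S.flow (0, 1) 2).1 ^ (p - 2) - 1 :=
    sub_pos.2 (Real.one_lt_rpow h2 (by linarith))
  set k := (S.flow (0, 1) 2).1 ^ (p - 2) - 1 with hk_def
  have hdec : ∀ x, 2 ≤ x → (S.flow (0, 1) x).1 -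
      |(S.flow (0, 1) x).1| ^ (p - 2) * (S.flow (0, 1) x).1 ≤ -k := by
    intro x hx
    have h0 : (S.flow (0, 1) 2).1 ≤ (S.flow (0, 1) x).1 :=
      hmono.monotoneOn (Set.mem_Ici.2 zero_le_two) (Set.mem_Ici.2 (by linarith)) hx
    have h1 : (S.flow (0, 1) 2).1 ^ (p - 2) ≤ (S.flow (0, 1) x).1 ^ (p - 2) :=
      Real.rpow_le_rpow (by linarith) h0 (by linarith)
    rw [abs_of_nonneg (by linarith)]
    nlinarith
  -- Beyond time `2` the velocity falls at rate at least `k`, so it would be exhausted after the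
  -- further time `T`.
  set T := (S.flow (0, 1) 2).2 / k with hT
  have hT0 : 0 ≤ T := div_nonneg (hpos 2 zero_le_two).le hk.le
  have := (convex_Icc (2 : ℝ) (2 + T)).image_sub_le_mul_sub_of_deriv_le
      (f := fun y => (S.flow (0, 1) y).2) hcw.continuousOn
      (fun x hx => (hw x (by linarith [(interior_subset hx).1])).differentiableAt.differentiableWithinAt)
      (C := -k) (fun x hx => by
        have h2x : 2 ≤ x := (interior_subset hx).1
        rw [(hw x (by linarith)).deriv]; exact hdec x h2x)
      2 ⟨le_rfl, by linarith⟩ (2 + T) ⟨by linarith, le_rfl⟩ (by linarith)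
  have h3 : k * T = (S.flow (0, 1) 2).2 := by rw [hT]; field_simp
  have h4 := hpos (2 + T) (by linarith)
  nlinarith

/-- The orbit of `(0, 1)` reaches negative positions: it is symmetric about a critical point. -/
theorem exists_position_neg (hp : 2 < p) : ∃ L, 0 < L ∧ (S.flow (0, 1) L).1 < 0 := by
  have hR := S.three_le
  have hz : ‖((0 : ℝ), (1 : ℝ))‖ < S.R := by simp [Prod.norm_def]; linarith
  have hE : nlsEnergy p (0, 1) ≤ 2 := by
    simp [nlsEnergy, Real.zero_rpow (by linarith : p ≠ 0)]; norm_num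
  have hd := fun x (hx : 0 ≤ x) => S.hasDerivAt_of_energy_le hp hz hE hx
  obtain ⟨x, hx, hwx⟩ := S.exists_velocity_eq_zero hp
  -- The equation is reversible: reflecting in time about `x` and flipping the velocity gives
  -- another solution, with the same state at `s = 0` because the velocity vanishes there. By
  -- uniqueness the state at `x + x` is $(0,-1)$.
  have href : ∀ s ∈ Set.Icc 0 x, HasDerivAt
      (fun s => ((S.flow (0, 1) (x - s)).1, -(S.flow (0, 1) (x - s)).2))
      (S.F ((S.flow (0, 1) (x - s)).1, -(S.flow (0, 1) (x - s)).2)) s := by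
    intro s hs
    have hxs : 0 ≤ x - s := sub_nonneg.2 hs.2
    have h1 := (hd (x - s) hxs).scomp s ((hasDerivAt_id s).const_sub x)
    have hn := (S.invariant hp hz hE hxs).1.le
    rw [S.eq_field _ (by simpa [Prod.norm_def] using hn)]
    have h2 := h1.component_fst.prodMk h1.component_snd.neg
    refine HasDerivAt.congr_deriv h2 ?_
    simp [nlsField]
  have hc : Continuous fun s => ((S.flow (0, 1) (x - s)).1, -(S.flow (0, 1) (x - s)).2) := by
    have := S.continuous_flow (0, 1)
    fun_prop
  have hsym := ODE_solution_unique (v := fun _ => S.F) (K := S.K) (a := 0) (b := x)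
    (f := fun s => S.flow (0, 1) (x + s)) (fun _ => S.lipschitz)
    ((S.continuous_flow _).comp (continuous_const.add continuous_id)).continuousOn
    (fun s _ => ((S.hasDerivAt (0, 1) (x + s)).comp_const_add x s).hasDerivWithinAt)
    hc.continuousOn (fun s hs => (href s ⟨hs.1, hs.2.le⟩).hasDerivWithinAt)
    (by simp [Prod.ext_iff, hwx]) (Set.right_mem_Icc.2 hx.le)
  simp only [sub_self, S.flow_zero] at hsym
  by_contra! hcon
  have hmin : IsLocalMin (fun y => (S.flow (0, 1) y).1) (x + x) := by
    filter_upwards [lt_mem_nhds (by linarith : 0 < x + x)] with y hy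
    rw [hsym]
    exact hcon y hy
  have := hmin.hasDerivAt_eq_zero (hd (x + x) (by linarith)).component_fst
  rw [hsym] at this
  simp [nlsField] at this

/-- Orbits that start in the open first quadrant close to `0` keep a positive position. -/
theorem position_pos_of_small (hp : 2 < p) {z : ℝ × ℝ} (h1 : 0 < z.1) (h2 : 0 < z.2) {l : ℝ}
    (hz : ‖z‖ * Real.exp (S.K * l) ≤ 1) (hE : nlsEnergy p z ≤ 2) :
    ∀ x ∈ Set.Icc 0 l, 0 < (S.flow z x).1 := by
  intro x hx
  have hl : 0 ≤ l := hx.1.trans hx.2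
  have hsmall : ∀ y ∈ Set.Icc 0 l, ‖S.flow z y‖ ≤ 1 := fun y hy => by
    refine (S.norm_flow_le z hy.1).trans (le_trans ?_ hz)
    gcongr
    exact hy.2
  have hz1 : ‖z‖ < S.R := by
    have := hsmall 0 ⟨le_rfl, hl⟩
    rw [S.flow_zero] at this
    linarith [S.three_le]
  have hd := fun y (hy : 0 ≤ y) => S.hasDerivAt_of_energy_le hp hz1 hE hy
  -- $(uu')'=u'^2+u^2(1-|u|^{p-2})\ge0$ as long as $|u|\le1$. The product starts positive, so $u$
  -- cannot vanish.
  have hmono : MonotoneOn (fun y => (S.flow z y).1 * (S.flow z y).2) (Set.Icc 0 l) := by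
    have hder := fun y (hy : 0 ≤ y) => (hd y hy).component_fst.fun_mul (hd y hy).component_snd
    refine monotoneOn_of_deriv_nonneg (convex_Icc 0 l)
      ((S.continuous_flow z).fst.mul (S.continuous_flow z).snd).continuousOn
      (fun y hy => (hder y (interior_subset hy).1).differentiableAt.differentiableWithinAt)
      fun y hy => ?_
    rw [(hder y (interior_subset hy).1).deriv]
    have hr := one_sub_rpow_nonneg hp (abs_nonneg _)
      (norm_le_iff_abs.1 (hsmall y (interior_subset hy))).1
    simp only [nlsField]
    nlinarith [sq_nonneg (S.flow z y).2, mul_nonneg hr (sq_nonneg (S.flow z y).1)]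
  have hne : ∀ y ∈ Set.Icc 0 l, (S.flow z y).1 ≠ 0 := by
    intro y hy h0
    have := hmono ⟨le_rfl, hl⟩ hy hy.1
    simp only [h0, S.flow_zero, zero_mul] at this
    nlinarith
  by_contra! hcon
  obtain ⟨y, hy, hy0⟩ := intermediate_value_Icc' hx.1
    (f := fun y => (S.flow z y).1) (S.continuous_flow z).fst.continuousOn
    ⟨hcon, by simpa [S.flow_zero] using h1.le⟩
  exact hne y ⟨hy.1, hy.2.trans hx.2⟩ hy0

/-- For short times the orbit of `(0, m)` is close to the free motion, relative to `m`. -/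
theorem exists_short_time_bound (hp : 2 < p) : ∃ C, 0 < C ∧ ∀ m ∈ Set.Icc (0 : ℝ) 1,
    ∀ x ∈ Set.Icc (0 : ℝ) 1, |(S.flow (0, m) x).2 - m| ≤ C * m * x ∧
      |(S.flow (0, m) x).1 - m * x| ≤ C * m * x * x := by
  -- On $[0,1]$ the field is at most $K\cdot me^{K}$ along the orbit, as it is $K$-Lipschitz and
  -- vanishes at `0`; the `+ 1` only secures positivity.
  refine ⟨S.K * Real.exp S.K + 1, by positivity, fun m hm x hx => ?_⟩
  have hnm : ‖((0 : ℝ), m)‖ = m := by simp [Prod.norm_def, abs_of_nonneg hm.1, hm.1]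
  have hz : ‖((0 : ℝ), m)‖ < S.R := by rw [hnm]; linarith [S.three_le, hm.2]
  have hE : nlsEnergy p (0, m) ≤ 2 := by
    simp only [nlsEnergy, abs_zero, Real.zero_rpow (by linarith : p ≠ 0), zero_div]
    nlinarith [hm.1, hm.2]
  have hw : ∀ y ∈ Set.Icc (0 : ℝ) 1,
      |(S.flow (0, m) y).2 - m| ≤ (S.K * Real.exp S.K + 1) * m * y := by
    intro y hy
    have := norm_image_sub_le_of_norm_deriv_le_segment' (f := fun s => (S.flow (0, m) s).2)
      (a := 0) (b := y) (C := (S.K * Real.exp S.K + 1) * m)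
      (fun s _ => (S.hasDerivAt (0, m) s).component_snd.hasDerivWithinAt) (fun s hs => ?_) y ⟨hy.1, le_rfl⟩
    · simpa [S.flow_zero] using this
    · have h1 : ‖S.F (S.flow (0, m) s)‖ ≤ S.K * ‖S.flow (0, m) s‖ := by
        simpa [S.F_zero] using S.lipschitz.dist_le_mul (S.flow (0, m) s) 0
      have h2 : ‖S.flow (0, m) s‖ ≤ m * Real.exp S.K := by
        have h3 := S.norm_flow_le (0, m) hs.1
        rw [hnm] at h3
        refine h3.trans ?_
        have := hm.1
        gcongr
        exact mul_le_of_le_one_right S.K.2 (by linarith [hs.2, hy.2])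
      have h4 := mul_le_mul_of_nonneg_left h2 S.K.2
      refine (norm_snd_le _).trans (h1.trans (h4.trans ?_))
      change (S.K : ℝ) * (m * Real.exp S.K) ≤ _
      nlinarith [hm.1]
  refine ⟨hw x hx, ?_⟩
  have := norm_image_sub_le_of_norm_deriv_le_segment' (f := fun s => (S.flow (0, m) s).1 - m * s)
    (f' := fun s => (S.flow (0, m) s).2 - m)
    (a := 0) (b := x) (C := (S.K * Real.exp S.K + 1) * m * x)
    (fun s hs => ?_) (fun s hs => ?_) x ⟨hx.1, le_rfl⟩
  · simpa [S.flow_zero] using this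
  · have h1 := (S.hasDerivAt_of_energy_le hp hz hE hs.1).component_fst
    have h2 := (hasDerivAt_id s).const_mul m
    rw [mul_one] at h2
    exact (h1.sub h2).hasDerivWithinAt
  · refine (hw s ⟨hs.1, by linarith [hs.2, hx.2]⟩).trans ?_
    have := hm.1
    gcongr
    exact hs.2.le

end NlsFlow

end Shooting

/-! ### Matching at the origin and choice of the shooting parameter -/

section ShootingData

/-- The slope of the soliton profile at height `t`, up to sign. -/
noncomputable def solitonSlope (p t : ℝ) : ℝ := t * √(1 - 2 / p * t ^ (p - 2))

theorem solitonSlope_radicand_pos {p t : ℝ} (hp : 2 < p) (ht : 0 ≤ t) (ht1 : t ≤ 1) :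
    0 < 1 - 2 / p * t ^ (p - 2) := by
  have h1 : t ^ (p - 2) ≤ 1 := Real.rpow_le_one ht ht1 (by linarith)
  have h2 : 2 / p < 1 := (div_lt_one (by linarith)).2 hp
  have h3 : 0 < 2 / p := by positivity
  nlinarith

theorem solitonSlope_pos {p t : ℝ} (hp : 2 < p) (ht : 0 < t) (ht1 : t ≤ 1) :
    0 < solitonSlope p t :=
  mul_pos ht (Real.sqrt_pos.2 (solitonSlope_radicand_pos hp ht.le ht1))

theorem solitonSlope_le {p t : ℝ} (hp : 2 < p) (ht : 0 ≤ t) : solitonSlope p t ≤ t := by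
  refine mul_le_of_le_one_right ht (Real.sqrt_le_one.2 ?_)
  have : 0 ≤ 2 / p * t ^ (p - 2) := by positivity
  linarith

/-- This says that $(t,\pm q)$ lies on the zero energy level, to which decaying solutions belong. -/
theorem solitonSlope_sq {p t : ℝ} (hp : 2 < p) (ht : 0 ≤ t) (ht1 : t ≤ 1) :
    solitonSlope p t ^ 2 = t ^ 2 - 2 / p * |t| ^ p := by
  rw [solitonSlope, mul_pow, Real.sq_sqrt (solitonSlope_radicand_pos hp ht ht1).le, abs_rpow_eq hp,
    abs_of_nonneg ht]
  ring

theorem continuous_solitonSlope {p : ℝ} (hp : 2 < p) : Continuous (solitonSlope p) :=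
  continuous_id.mul (Real.continuous_sqrt.comp
    (continuous_const.sub (continuous_const.mul (Real.continuous_rpow_const (by linarith)))))

namespace NlsFlow

variable {p : ℝ} (S : NlsFlow p)

/-- Initial data at the origin on the long edge: the short edge is traversed by the orbit of
`(0, m)`, and the slope on the half-line is `σ * solitonSlope`. -/
noncomputable def longEdgeData (l σ m : ℝ) : ℝ × ℝ :=
  ((S.flow (0, m) l).1, (S.flow (0, m) l).2 - σ * solitonSlope p (S.flow (0, m) l).1)

theorem continuous_longEdgeData (hp : 2 < p) {l : ℝ} (hl : 0 ≤ l) (σ : ℝ) :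
    Continuous (S.longEdgeData l σ) := by
  have h : Continuous fun m : ℝ => S.flow (0, m) l := by
    have := S.continuous_flow_max.comp
      (show Continuous fun m : ℝ => (((0 : ℝ), m), l) by fun_prop)
    simpa [Function.comp_def, max_eq_left hl] using this
  exact h.fst.prodMk (h.snd.sub (continuous_const.mul ((continuous_solitonSlope hp).comp h.fst)))

theorem exists_longEdgeData_bounds (hp : 2 < p) : ∃ C, 0 < C ∧ ∃ a, 0 < a ∧
    ∀ l σ m, 0 < l → l < a → |σ| = 1 → m ∈ Set.Ioc (0 : ℝ) 1 →
      (∀ x ∈ Set.Icc 0 l, 0 ≤ (S.flow (0, m) x).1) ∧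
      0 < (S.longEdgeData l σ m).1 ∧ (S.longEdgeData l σ m).1 < 1 ∧
      0 < (S.longEdgeData l σ m).2 ∧
      (S.longEdgeData l σ m).1 ≤ C * m * l ∧ |(S.longEdgeData l σ m).2 - m| ≤ C * m * l ∧
      ‖S.longEdgeData l σ m‖ ≤ 2 * m ∧
      0 < nlsEnergy p (S.longEdgeData l σ m) ∧ nlsEnergy p (S.longEdgeData l σ m) ≤ 2 := by
  obtain ⟨C, hC, hb⟩ := S.exists_short_time_bound hp
  -- The two thresholds yield $t\le\frac54m\ell\le\frac5{64}m$ and $s\ge\frac34m$, whence $2q<s$.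
  -- The `+ 2` absorbs the contributions of $t$ and $q$.
  refine ⟨C + 2, by linarith, min (1 / 16) (1 / (4 * C)), by positivity, ?_⟩
  intro l σ m hl hla hσ hm
  have hm0 := hm.1
  have hm1 := hm.2
  have hl16 : l < 1 / 16 := hla.trans_le (min_le_left _ _)
  have hCl : C * l ≤ 1 / 4 := by
    have := (hla.trans_le (min_le_right _ _)).le
    rw [le_div_iff₀ (by positivity)] at this
    linarith
  have hml : 0 < m * l := mul_pos hm0 hl
  have hml1 : m * l < 1 / 16 := by nlinarith
  have hCml : C * m * l ≤ m / 4 := by nlinarith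
  have hCmll : C * m * l * l ≤ m * l / 4 := by nlinarith
  obtain ⟨hw, hu⟩ := hb m ⟨hm0.le, hm1⟩ l ⟨hl.le, by linarith⟩
  have hw' := abs_le.1 hw
  have hu' := abs_le.1 hu
  simp only [longEdgeData]
  set t := (S.flow (0, m) l).1
  set s := (S.flow (0, m) l).2
  have ht0 : 0 < t := by linarith
  have ht1 : t < 1 := by linarith
  have htm : t ≤ 5 / 4 * (m * l) := by linarith
  have htm' : t ≤ 5 / 64 * m := by nlinarith
  have hq0 := solitonSlope_pos hp ht0 ht1.le
  have hq1 := solitonSlope_le hp ht0.le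
  have hqq := solitonSlope_sq hp ht0.le ht1.le
  set q := solitonSlope p t
  have hσ2 : (σ * q) ^ 2 = q ^ 2 := by rw [mul_pow, ← sq_abs, hσ]; ring
  have hσq : |σ * q| ≤ t := by rw [abs_mul, hσ, one_mul, abs_of_pos hq0]; exact hq1
  have hσq' := abs_le.1 hσq
  have hE : nlsEnergy p (t, s - σ * q) = s * (s - 2 * (σ * q)) / 2 := by
    have : |t| ^ p / p = (t ^ 2 - q ^ 2) / 2 := by rw [hqq]; field_simp; ring
    rw [nlsEnergy, this]
    linear_combination hσ2 / 2
  refine ⟨fun x hx => ?_, ht0, ht1, by linarith, by nlinarith, ?_, ?_, ?_, ?_⟩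
  · have := (abs_le.1 (hb m ⟨hm0.le, hm1⟩ x ⟨hx.1, by linarith [hx.2]⟩).2).1
    have h1 : C * x ≤ 1 / 4 := le_trans (by gcongr; exact hx.2) hCl
    nlinarith [mul_nonneg hm0.le hx.1]
  · rw [abs_le]; constructor <;> nlinarith
  · refine norm_le_iff_abs.2 ⟨?_, ?_⟩ <;> rw [abs_le] <;> constructor <;> simp only <;> linarith
  · rw [hE]
    have : 0 < s * (s - 2 * (σ * q)) := mul_pos (by linarith) (by linarith)
    linarith
  · rw [hE]
    have : s * (s - 2 * (σ * q)) ≤ 2 * 2 :=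
      mul_le_mul (by linarith) (by linarith) (by linarith) zero_le_two
    linarith

/-- The shooting argument: for a short edge and a long edge, matching data at the origin exist. -/
theorem exists_shooting (hp : 2 < p) : ∃ a, 0 < a ∧ ∃ L, 0 < L ∧
    ∀ l₁ l₂ σ, 0 < l₁ → l₁ < a → L < l₂ → |σ| = 1 → ∃ m ∈ Set.Ioc (0 : ℝ) 1,
      (∀ x ∈ Set.Icc 0 l₁, 0 ≤ (S.flow (0, m) x).1) ∧
      0 < (S.longEdgeData l₁ σ m).1 ∧ (S.longEdgeData l₁ σ m).1 < 1 ∧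
      ‖S.longEdgeData l₁ σ m‖ < S.R ∧ nlsEnergy p (S.longEdgeData l₁ σ m) ≤ 2 ∧
      (∀ x ∈ Set.Icc 0 l₂, 0 ≤ (S.flow (S.longEdgeData l₁ σ m) x).1) ∧
      (S.flow (S.longEdgeData l₁ σ m) l₂).1 = 0 := by
  obtain ⟨C, hC, a, ha, hb⟩ := S.exists_longEdgeData_bounds hp
  obtain ⟨L, hL, hneg⟩ := S.exists_position_neg hp
  -- For $\ell_1<\delta$ the Grönwall distance $C\ell_1e^{KL}$ to the orbit of $(0,1)$ at time `L`
  -- is smaller than the depth reached there.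
  set δ := -(S.flow (0, 1) L).1 / (C * Real.exp (S.K * L)) with hδ
  have hδ0 : 0 < δ := div_pos (by linarith) (by positivity)
  refine ⟨min a δ, lt_min ha hδ0, L, hL, fun l₁ l₂ σ hl₁ hla hLl hσ => ?_⟩
  have hb' := fun m hm => hb l₁ σ m hl₁ (hla.trans_le (min_le_left _ _)) hσ hm
  have hl₂ : 0 < l₂ := hL.trans hLl
  set f : ℝ → ℝ → ℝ := fun m x => (S.flow (S.longEdgeData l₁ σ m) (max x 0)).1
  have hf : Continuous ↿f := by
    have h1 := S.continuous_longEdgeData hp hl₁.le σ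
    exact (S.continuous_flow_max.comp
      ((h1.comp continuous_fst).prodMk (continuous_snd (X := ℝ) (Y := ℝ)))).fst
  -- The data have norm at most $2m_0=e^{-K\ell_2}$, exactly the smallness that keeps the orbit
  -- positive up to $\ell_2$.
  set m₀ := Real.exp (-(S.K * l₂)) / 2 with hm₀
  have hm₀0 : 0 < m₀ := by positivity
  have hm₀1 : m₀ ≤ 1 := by
    have : Real.exp (-(S.K * l₂)) ≤ 1 := Real.exp_le_one_iff.2 (neg_nonpos.2 (by positivity))
    linarith
  obtain ⟨m, hm, hnn, x, hx, hfx⟩ := exists_nonneg_with_zero hf hm₀1 hl₂.le (fun x hx => by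
    obtain ⟨-, h1, -, h2, -, -, h3, -, h4⟩ := hb' m₀ ⟨hm₀0, hm₀1⟩
    have h5 : ‖S.longEdgeData l₁ σ m₀‖ * Real.exp (S.K * l₂) ≤ 1 := by
      refine (mul_le_mul_of_nonneg_right h3 (Real.exp_pos _).le).trans ?_
      rw [hm₀, mul_div_cancel₀ _ two_ne_zero, ← Real.exp_add, neg_add_cancel, Real.exp_zero]
    simpa only [f, max_eq_left hx.1] using S.position_pos_of_small hp h1 h2 h5 h4 x hx) (by
    refine ⟨L, ⟨hL.le, hLl.le⟩, ?_⟩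
    obtain ⟨-, h1, -, -, h2, h3, -⟩ := hb' 1 ⟨one_pos, le_rfl⟩
    rw [mul_one] at h2 h3
    have h4 : dist (S.longEdgeData l₁ σ 1) (0, 1) ≤ C * l₁ := by
      rw [dist_eq_norm]
      refine norm_le_iff_abs.2 ⟨?_, h3⟩
      simpa [abs_of_pos h1] using h2
    have h5 := (S.dist_flow_le (S.longEdgeData l₁ σ 1) (0, 1) hL.le).trans
      (mul_le_mul_of_nonneg_right h4 (Real.exp_pos _).le)
    have h6 : l₁ * (C * Real.exp (S.K * L)) < -(S.flow (0, 1) L).1 := by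
      rw [← lt_div_iff₀ (by positivity)]
      exact hla.trans_le (min_le_right _ _)
    rw [dist_eq_norm] at h5
    have h7 := (abs_le.1 ((norm_fst_le _).trans h5 :
      |(S.flow (S.longEdgeData l₁ σ 1) L - S.flow (0, 1) L).1| ≤ _)).2
    simp only [f, max_eq_left hL.le]
    simp only [Prod.fst_sub] at h7
    linarith)
  have hm' : m ∈ Set.Ioc (0 : ℝ) 1 := ⟨hm₀0.trans_le hm.1, hm.2⟩
  obtain ⟨h1, h2, h3, -, -, -, h4, h5, h6⟩ := hb' m hm'
  have hR : ‖S.longEdgeData l₁ σ m‖ < S.R := by linarith [S.three_le, hm.2]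
  have hnn' : ∀ x ∈ Set.Icc 0 l₂, 0 ≤ (S.flow (S.longEdgeData l₁ σ m) x).1 := fun x hx => by
    simpa only [f, max_eq_left hx.1] using hnn x hx
  simp only [f, max_eq_left hx.1] at hfx
  refine ⟨m, hm', h1, h2, h3, hR, h6, hnn', ?_⟩
  -- A zero at `0` is excluded by $t>0$. At an interior zero the minimum forces zero velocity, hence
  -- zero energy, contradicting `h5`.
  rcases hx.2.eq_or_lt with rfl | hlt
  · exact hfx
  exfalso
  have hx0 : 0 < x := by
    refine hx.1.lt_of_ne ?_
    rintro rfl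
    rw [S.flow_zero] at hfx
    exact h2.ne' hfx
  have hmin : IsLocalMin (fun y => (S.flow (S.longEdgeData l₁ σ m) y).1) x := by
    filter_upwards [Icc_mem_nhds hx0 hlt] with y hy
    rw [hfx]
    exact hnn' y hy
  have hd := hmin.hasDerivAt_eq_zero (S.hasDerivAt_of_energy_le hp hR h6 hx.1).component_fst
  have hE := (S.invariant hp hR h6 hx.1).2
  simp only [nlsField] at hd
  rw [← hE, nlsEnergy, hd, hfx, abs_zero, Real.zero_rpow (by linarith)] at h5
  norm_num at h5

end NlsFlow

end ShootingData

/-! ### Explicit solitons on the half-line -/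

section Soliton

theorem hasDerivAt_cosh_rpow (c r y x : ℝ) (hr : r ≠ 0) :
    HasDerivAt (fun x => c * Real.cosh (x / r + y) ^ (-r))
      (-(c * Real.cosh (x / r + y) ^ (-r)) * (Real.sinh (x / r + y) / Real.cosh (x / r + y))) x := by
  have h1 : HasDerivAt (fun x => x / r + y) (1 / r) x := ((hasDerivAt_id x).div_const r).add_const y
  have hpos := Real.cosh_pos (x / r + y)
  have h2 := ((h1.cosh).rpow_const (p := -r) (Or.inl hpos.ne')).const_mul c
  refine h2.congr_deriv ?_
  rw [Real.rpow_sub hpos, Real.rpow_one]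
  field_simp

theorem hasDerivAt_sinh_div_cosh (r y x : ℝ) :
    HasDerivAt (fun x => Real.sinh (x / r + y) / Real.cosh (x / r + y))
      (1 / r / Real.cosh (x / r + y) ^ 2) x := by
  have h1 : HasDerivAt (fun x => x / r + y) (1 / r) x := ((hasDerivAt_id x).div_const r).add_const y
  have hpos := Real.cosh_pos (x / r + y)
  refine (h1.sinh.fun_div h1.cosh hpos.ne').congr_deriv ?_
  congr 1
  linear_combination (1 / r) * Real.cosh_sq (x / r + y)

/-- The decaying solutions of `u'' = u - |u|^(p-2) u` on the half-line, with prescribed value and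
sign of the slope at `0`. -/
theorem exists_soliton {p t σ : ℝ} (hp : 2 < p) (ht : 0 < t) (ht1 : t < 1) (hσ : |σ| = 1) :
    ∃ u w : ℝ → ℝ, (∀ x, HasDerivAt u (w x) x) ∧
      (∀ x, HasDerivAt w (u x - |u x| ^ (p - 2) * u x) x) ∧ (∀ x, 0 ≤ u x) ∧ u 0 = t ∧
      w 0 = σ * solitonSlope p t ∧ (∀ x, |w x| ≤ u x) ∧ ∃ C, ∀ x, u x ≤ C * Real.exp (-x) := by
  have hp2 : 0 < p - 2 := by linarith
  set r := 2 / (p - 2) with hr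
  have hr0 : 0 < r := by positivity
  set c := (p / 2) ^ (1 / (p - 2)) with hc
  have hc1 : 1 ≤ c := Real.one_le_rpow (by linarith) (by positivity)
  have hc0 : 0 < c := by linarith
  have hcp : c ^ (p - 2) = p / 2 := by
    rw [hc, ← Real.rpow_mul (by linarith), one_div_mul_cancel hp2.ne', Real.rpow_one]
  -- `A` is the value of $\cosh$ at $x=0$ forced by $cA^{-r}=t$. The phase
  -- $-\sigma\,\mathrm{arcosh}\,A$ then selects the sign of the slope.
  set A := (c / t) ^ (1 / r) with hA
  have hA1 : 1 ≤ A := Real.one_le_rpow ((one_le_div ht).2 (by linarith)) (by positivity)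
  have hA0 : 0 < A := by linarith
  have hAr : c * A ^ (-r) = t := by
    rw [hA, ← Real.rpow_mul (by positivity)]
    rw [show 1 / r * -r = -1 by field_simp, Real.rpow_neg_one]
    field_simp
  have hrp : r * (p - 2) = 2 := by rw [hr]; field_simp
  have hpow : ∀ B : ℝ, 0 < B → (c * B ^ (-r)) ^ (p - 2) = p / 2 / B ^ 2 := by
    intro B hB
    rw [Real.mul_rpow hc0.le (by positivity), hcp, ← Real.rpow_mul hB.le, neg_mul, hrp,
      Real.rpow_neg hB.le, Real.rpow_two]
    rfl
  have hslope : t * (√(A ^ 2 - 1) / A) = solitonSlope p t := by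
    have h1 := hpow A hA0
    rw [hAr] at h1
    rw [solitonSlope, h1]
    congr 1
    rw [show 1 - 2 / p * (p / 2 / A ^ 2) = (A ^ 2 - 1) / A ^ 2 by field_simp,
      Real.sqrt_div' _ (sq_nonneg A), Real.sqrt_sq hA0.le]
  set y := Real.arcosh A
  have hcy : Real.cosh (-(σ * y)) = A := by
    rw [Real.cosh_neg, ← Real.cosh_abs, abs_mul, hσ, one_mul, Real.cosh_abs,
      Real.cosh_arcosh hA1]
  have hsy : Real.sinh (-(σ * y)) = -(σ * √(A ^ 2 - 1)) := by
    rcases (abs_eq zero_le_one).1 hσ with h | h <;>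
      simp [h, y, Real.sinh_arcosh hA1]
  have hpos : ∀ x, 0 < c * Real.cosh (x / r + -(σ * y)) ^ (-r) := fun x => by
    have := Real.cosh_pos (x / r + -(σ * y))
    positivity
  refine ⟨fun x => c * Real.cosh (x / r + -(σ * y)) ^ (-r),
    fun x => -(c * Real.cosh (x / r + -(σ * y)) ^ (-r)) *
      (Real.sinh (x / r + -(σ * y)) / Real.cosh (x / r + -(σ * y))),
    fun x => hasDerivAt_cosh_rpow c r _ x hr0.ne', fun x => ?_, fun x => (hpos x).le, ?_, ?_,
    fun x => ?_, ?_⟩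
  · have hch := Real.cosh_pos (x / r + -(σ * y))
    have hsq := Real.sinh_sq (x / r + -(σ * y))
    refine ((hasDerivAt_cosh_rpow c r (-(σ * y)) x hr0.ne').fun_neg.fun_mul
      (hasDerivAt_sinh_div_cosh r (-(σ * y)) x)).congr_deriv ?_
    beta_reduce
    rw [abs_of_pos (hpos x), hpow _ hch]
    -- $u''=u\,(1-(1+1/r)\cosh^{-2})$ while $u^{p-2}=(p/2)\cosh^{-2}$; this identity matches them.
    have hp' : p / 2 = 1 + 1 / r := by rw [hr]; field_simp; ring
    rw [hp']
    generalize Real.sinh (x / r + -(σ * y)) = sh at hsq ⊢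
    generalize Real.cosh (x / r + -(σ * y)) = ch at hsq hch ⊢
    field_simp
    rw [hsq]
    ring
  · simp only [zero_div, zero_add, hcy, hAr]
  · simp only [zero_div, zero_add, hcy, hAr, hsy, ← hslope]
    ring
  · have hch := Real.cosh_pos (x / r + -(σ * y))
    beta_reduce
    rw [neg_mul, abs_neg, abs_mul, abs_of_pos (hpos x)]
    refine mul_le_of_le_one_right (hpos x).le ?_
    rw [abs_div, abs_of_pos hch, div_le_one hch]
    refine abs_le_of_sq_le_sq ?_ hch.le
    rw [Real.cosh_sq]; linarith
  -- From $\cosh\xi\ge e^{\xi}/2$ at $\xi=x/r-\sigma y$, raised to the power $-r$.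
  · refine ⟨c * (Real.exp (-(σ * y)) / 2) ^ (-r), fun x => ?_⟩
    beta_reduce
    rw [mul_assoc]
    gcongr
    have h1 : Real.exp (-x) = (Real.exp (x / r)) ^ (-r) := by
      rw [← Real.exp_mul]; congr 1; field_simp
    rw [h1, ← Real.mul_rpow (by positivity) (by positivity)]
    refine Real.rpow_le_rpow_of_nonpos (by positivity) ?_ (by linarith)
    rw [Real.cosh_eq, div_mul_eq_mul_div, ← Real.exp_add, add_comm (-(σ * y))]
    have := Real.exp_pos (-(x / r + -(σ * y)))
    linarith

end Soliton

/-! ### Sobolev and classical regularity on an edge -/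

section EdgeRegularity

/-- Integration by parts: a classical derivative is a weak derivative. -/
theorem StarMetricGraph.isWeakDeriv_of_hasDerivAt {U : Set ℝ} {f g : ℝ → ℝ}
    (hf : ∀ x, HasDerivAt f (g x) x) (hg : Continuous g) :
    StarMetricGraph.IsWeakDeriv U f g := by
  intro φ hφ hc hsupp
  have hfc : Continuous f := continuous_iff_continuousAt.2 fun x => (hf x).continuousAt
  have hφ' : Continuous (deriv φ) := hφ.continuous_deriv (by simp)
  -- Both integrands vanish off `U`, so integration by parts takes place on the whole line without
  -- boundary terms.
  have h1 : ∀ x, x ∉ U → f x * deriv φ x = 0 := fun x hx => by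
    rw [image_eq_zero_of_notMem_tsupport fun h => hx (hsupp (tsupport_deriv_subset (𝕜 := ℝ) h)),
      mul_zero]
  have h2 : ∀ x, x ∉ U → g x * φ x = 0 := fun x hx => by
    rw [image_eq_zero_of_notMem_tsupport fun h => hx (hsupp h), mul_zero]
  rw [setIntegral_eq_integral_of_forall_compl_eq_zero h1,
    setIntegral_eq_integral_of_forall_compl_eq_zero h2]
  exact integral_mul_deriv_eq_deriv_mul_of_integrable (fun x _ => hf x)
    (fun x _ => (hφ.differentiable (by simp) x).hasDerivAt)
    ((hfc.mul hφ').integrable_of_hasCompactSupport hc.deriv.mul_left)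
    ((hg.mul hφ.continuous).integrable_of_hasCompactSupport hc.mul_left)
    ((hfc.mul hφ.continuous).integrable_of_hasCompactSupport hc.mul_left)

theorem Continuous.memLp_restrict_of_subset_Icc {f : ℝ → ℝ} (hf : Continuous f) {U : Set ℝ}
    {a b : ℝ} (hU : U ⊆ Set.Icc a b) (q : ℝ≥0∞) : MemLp f q (volume.restrict U) := by
  obtain ⟨C, hC⟩ := isCompact_Icc.exists_bound_of_continuousOn (s := Set.Icc a b) hf.continuousOn
  have h : MemLp f q (volume.restrict (Set.Icc a b)) :=
    MemLp.of_bound hf.aestronglyMeasurable C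
      ((ae_restrict_iff' measurableSet_Icc).2 (Filter.Eventually.of_forall hC))
  exact h.mono_measure (Measure.restrict_mono hU le_rfl)

theorem memLp_two_restrict_Ioi_of_abs_le_exp {f : ℝ → ℝ} (hf : Continuous f) {C : ℝ}
    (h : ∀ x, |f x| ≤ C * Real.exp (-x)) : MemLp f 2 (volume.restrict (Set.Ioi 0)) := by
  have h1 : MemLp (fun x : ℝ => Real.exp (-x)) 2 (volume.restrict (Set.Ioi 0)) := by
    rw [memLp_two_iff_integrable_sq (by fun_prop)]
    refine (exp_neg_integrableOn_Ioi 0 two_pos).congr (Filter.Eventually.of_forall fun x => ?_)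
    simp only [← Real.exp_nat_mul]
    congr 1; push_cast; ring
  refine (h1.const_mul C).mono hf.aestronglyMeasurable (Filter.Eventually.of_forall fun x => ?_)
  exact (h x).trans (le_abs_self _)

theorem contDiffOn_two_of_hasDerivAt {s : Set ℝ} (hs : IsOpen s) {u w f : ℝ → ℝ}
    (hu : ∀ x ∈ s, HasDerivAt u (w x) x) (hw : ∀ x ∈ s, HasDerivAt w (f x) x)
    (hf : ContinuousOn f s) :
    ContDiffOn ℝ 2 u s ∧ ∀ x ∈ s, deriv (deriv u) x = f x := by
  have h2 : ∀ x ∈ s, deriv w x = f x := fun x hx => (hw x hx).deriv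
  have h1 : ∀ x ∈ s, deriv u x = w x := fun x hx => (hu x hx).deriv
  have hwc : ContDiffOn ℝ 1 w s := by
    rw [show (1 : WithTop ℕ∞) = 0 + 1 from (zero_add 1).symm, contDiffOn_succ_iff_deriv_of_isOpen hs]
    exact ⟨fun x hx => (hw x hx).differentiableAt.differentiableWithinAt, by simp,
      contDiffOn_zero.2 (hf.congr h2)⟩
  constructor
  · rw [show (2 : WithTop ℕ∞) = 1 + 1 from one_add_one_eq_two.symm,
      contDiffOn_succ_iff_deriv_of_isOpen hs]
    exact ⟨fun x hx => (hu x hx).differentiableAt.differentiableWithinAt, by simp, hwc.congr h1⟩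
  · intro x hx
    have : deriv u =ᶠ[nhds x] w := Filter.eventually_of_mem (hs.mem_nhds hx) h1
    rw [this.deriv_eq, h2 x hx]

end EdgeRegularity

/-! ### Assembly of the solutions on the graph -/

namespace StarMetricGraph

variable {ι : Type*}

theorem edge_of_length_eq_top {G : StarMetricGraph ι} {i : ι} (h : G.length i = ⊤) :
    G.edge i = Set.Ici 0 ∧ G.openEdge i = Set.Ioi 0 := by
  simp [edge, openEdge, h, Set.Ici, Set.Ioi]

theorem edge_of_length_eq_ofReal {G : StarMetricGraph ι} {i : ι} {l : ℝ} (hl : 0 < l)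
    (h : G.length i = ENNReal.ofReal l) :
    G.edge i = Set.Icc 0 l ∧ G.openEdge i = Set.Ioo 0 l := by
  constructor <;> ext x
  · simp [edge, h, ENNReal.ofReal_le_ofReal_iff hl.le]
  · simp [openEdge, h, ENNReal.ofReal_lt_ofReal_iff hl]

theorem memH1_bounded {f g : ℝ → ℝ} {l : ℝ} (hf : ∀ x, HasDerivAt f (g x) x)
    (hg : Continuous g) : MemH1 (Set.Ioo 0 l) f :=
  ⟨(continuous_iff_continuousAt.2 fun x => (hf x).continuousAt).memLp_restrict_of_subset_Icc
    Set.Ioo_subset_Icc_self 2, g, hg.memLp_restrict_of_subset_Icc Set.Ioo_subset_Icc_self 2,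
    isWeakDeriv_of_hasDerivAt hf hg⟩

theorem memH1_Ioi {f g : ℝ → ℝ} (hf : ∀ x, HasDerivAt f (g x) x) (hg : Continuous g) {C : ℝ}
    (hfC : ∀ x, |f x| ≤ C * Real.exp (-x)) (hgC : ∀ x, |g x| ≤ C * Real.exp (-x)) :
    MemH1 (Set.Ioi 0) f :=
  ⟨memLp_two_restrict_Ioi_of_abs_le_exp
    (continuous_iff_continuousAt.2 fun x => (hf x).continuousAt) hfC, g,
    memLp_two_restrict_Ioi_of_abs_le_exp hg hgC, isWeakDeriv_of_hasDerivAt hf hg⟩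

theorem continuous_nls_nonlinearity {p : ℝ} (hp : 2 < p) :
    Continuous fun u : ℝ => u - |u| ^ (p - 2) * u :=
  continuous_id.sub (((Real.continuous_rpow_const (by linarith)).comp continuous_abs).mul
    continuous_id)

/-- Classical solutions of the phase-plane system on an open set solve the edge equation. -/
theorem edge_equation_of_phasePlane {p : ℝ} (hp : 2 < p) {s : Set ℝ} (hs : IsOpen s) {u w : ℝ → ℝ}
    (hu : ∀ x ∈ s, HasDerivAt u (w x) x)
    (hw : ∀ x ∈ s, HasDerivAt w (u x - |u x| ^ (p - 2) * u x) x) :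
    ContDiffOn ℝ 2 u s ∧ ∀ x ∈ s, -deriv (deriv u) x + u x = |u x| ^ (p - 2) * u x := by
  have hf : ContinuousOn (fun x => u x - |u x| ^ (p - 2) * u x) s :=
    (continuous_nls_nonlinearity hp).comp_continuousOn fun x hx =>
      (hu x hx).continuousAt.continuousWithinAt
  obtain ⟨h1, h2⟩ := contDiffOn_two_of_hasDerivAt hs hu hw hf
  refine ⟨h1, fun x hx => ?_⟩
  rw [h2 x hx]; ring

/-- Solutions whose slope along the half-line has a prescribed sign. -/
theorem exists_solution_of_sign {p : ℝ} (hp : 2 < p) : ∃ a, 0 < a ∧ ∃ L, 0 < L ∧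
    ∀ (l₁ l₂ : ℝ) (h₁ : 0 < l₁) (h₂ : 0 < l₂), l₁ < a → L < l₂ → ∀ σ : ℝ, |σ| = 1 →
      ∃ v : Fin 3 → ℝ → ℝ, (halfLineTwoBounded l₁ l₂ h₁ h₂).IsKirkhoffODESolution p v ∧
        (halfLineTwoBounded l₁ l₂ h₁ h₂).Nonneg v ∧ 0 < v 0 0 ∧
        ∃ d, 0 < d ∧ HasDerivAt (v 0) (σ * d) 0 := by
  obtain ⟨S⟩ := nonempty_nlsFlow hp
  obtain ⟨a, ha, L, hL, H⟩ := S.exists_shooting hp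
  refine ⟨a, ha, L, hL, fun l₁ l₂ h₁ h₂ hla hLl σ hσ => ?_⟩
  obtain ⟨m, hm, hn1, ht0, ht1, hzR, hzE, hn2, hz0⟩ := H l₁ l₂ σ h₁ hla hLl hσ
  obtain ⟨u, w, hu, hw, hu_nn, hu0, hw0, hwu, C, hC⟩ := exists_soliton hp ht0 ht1 hσ
  set z := S.longEdgeData l₁ σ m with hz
  have hmR : ‖((0 : ℝ), m)‖ < S.R := by
    have : ‖((0 : ℝ), m)‖ = m := by simp [Prod.norm_def, abs_of_pos hm.1, hm.1.le]
    linarith [S.three_le, hm.2]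
  have hmE : nlsEnergy p (0, m) ≤ 2 := by
    simp only [nlsEnergy, abs_zero, Real.zero_rpow (by linarith : p ≠ 0), zero_div]
    nlinarith [hm.1, hm.2]
  have hFc : ∀ z', Continuous fun x => (S.F (S.flow z' x)).1 := fun z' =>
    (S.lipschitz.continuous.comp (S.continuous_flow z')).fst
  -- Edges are parametrized from the origin, so the orbit leaving the outer vertex of edge `1` is
  -- run backwards.
  set v : Fin 3 → ℝ → ℝ := ![u, fun x => (S.flow (0, m) (l₁ - x)).1, fun x => (S.flow z x).1]
    with hv
  have hd1 : ∀ x, HasDerivAt (v 1) (-(S.F (S.flow (0, m) (l₁ - x))).1) x := fun x =>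
    (S.hasDerivAt (0, m) (l₁ - x)).component_fst.comp_const_sub l₁ x
  have hd2 : ∀ x, HasDerivAt (v 2) (S.F (S.flow z x)).1 x := fun x =>
    (S.hasDerivAt z x).component_fst
  have hd : ∀ i, ∃ g : ℝ → ℝ, ∀ x, HasDerivAt (v i) (g x) x := by
    intro i
    fin_cases i
    exacts [⟨w, hu⟩, ⟨_, hd1⟩, ⟨_, hd2⟩]
  have hcont : ∀ i, Continuous (v i) := fun i =>
    let ⟨_, hg⟩ := hd i
    continuous_iff_continuousAt.2 fun x => (hg x).continuousAt
  set G := halfLineTwoBounded l₁ l₂ h₁ h₂ with hG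
  obtain ⟨e0, o0⟩ : G.edge 0 = Set.Ici 0 ∧ G.openEdge 0 = Set.Ioi 0 :=
    edge_of_length_eq_top rfl
  obtain ⟨e1, o1⟩ : G.edge 1 = Set.Icc 0 l₁ ∧ G.openEdge 1 = Set.Ioo 0 l₁ :=
    edge_of_length_eq_ofReal h₁ rfl
  obtain ⟨e2, o2⟩ : G.edge 2 = Set.Icc 0 l₂ ∧ G.openEdge 2 = Set.Ioo 0 l₂ :=
    edge_of_length_eq_ofReal h₂ rfl
  have hv00 : v 0 0 = z.1 := hu0
  have hv10 : v 1 0 = z.1 := by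
    change (S.flow (0, m) (l₁ - 0)).1 = z.1
    rw [sub_zero]; rfl
  have hv20 : v 2 0 = z.1 := by
    change (S.flow z 0).1 = z.1
    rw [S.flow_zero]
  have horigin : ∀ i, v i 0 = z.1 := by
    intro i
    fin_cases i
    exacts [hv00, hv10, hv20]
  have hC0 : ∀ x, |u x| ≤ C * Real.exp (-x) := fun x => by
    rw [abs_of_nonneg (hu_nn x)]; exact hC x
  have hwc : Continuous w := continuous_iff_continuousAt.2 fun x => (hw x).continuousAt
  refine ⟨v, ⟨⟨fun i => (hcont i).continuousOn, fun i j => by rw [horigin i, horigin j], ?_, ?_⟩,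
    ?_, ?_⟩, ?_, by rw [hv00]; exact ht0, solitonSlope p z.1, solitonSlope_pos hp ht0 ht1.le, ?_⟩
  · intro i
    fin_cases i
    · change MemH1 (G.openEdge 0) (v 0)
      rw [o0]
      exact memH1_Ioi hu hwc hC0 fun x => (hwu x).trans (hC x)
    · change MemH1 (G.openEdge 1) (v 1)
      rw [o1]
      exact memH1_bounded hd1 ((hFc (0, m)).comp (continuous_const.sub continuous_id)).neg
    · change MemH1 (G.openEdge 2) (v 2)
      rw [o2]
      exact memH1_bounded hd2 (hFc z)
  · intro i b hb
    fin_cases i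
    · intro h
      exact absurd h.symm ENNReal.ofReal_ne_top
    · intro h
      have : l₁ = b := (ENNReal.ofReal_eq_ofReal_iff h₁.le hb.le).1 h
      change (S.flow (0, m) (l₁ - b)).1 = 0
      rw [this, sub_self, S.flow_zero]
    · intro h
      have : l₂ = b := (ENNReal.ofReal_eq_ofReal_iff h₂.le hb.le).1 h
      rw [← this]
      exact hz0
  · intro i
    fin_cases i
    · change ContDiffOn ℝ 2 (v 0) (G.openEdge 0) ∧ ∀ x ∈ G.openEdge 0, _
      rw [o0]
      exact edge_equation_of_phasePlane hp isOpen_Ioi (fun x _ => hu x) fun x _ => hw x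
    · change ContDiffOn ℝ 2 (v 1) (G.openEdge 1) ∧ ∀ x ∈ G.openEdge 1, _
      rw [o1]
      have h := fun x (hx : x ∈ Set.Ioo 0 l₁) =>
        S.hasDerivAt_of_energy_le hp hmR hmE (sub_nonneg.2 hx.2.le)
      refine edge_equation_of_phasePlane hp isOpen_Ioo (w := fun x => -(S.flow (0, m) (l₁ - x)).2)
        (fun x hx => (h x hx).component_fst.comp_const_sub l₁ x) fun x hx => ?_
      refine ((h x hx).component_snd.comp_const_sub l₁ x).fun_neg.congr_deriv ?_
      rw [neg_neg]; rfl
    · change ContDiffOn ℝ 2 (v 2) (G.openEdge 2) ∧ ∀ x ∈ G.openEdge 2, _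
      rw [o2]
      have h := fun x (hx : x ∈ Set.Ioo 0 l₂) => S.hasDerivAt_of_energy_le hp hzR hzE hx.1.le
      exact edge_equation_of_phasePlane hp isOpen_Ioo (fun x hx => (h x hx).component_fst)
        fun x hx => (h x hx).component_snd
  · refine ⟨![w 0, -(S.flow (0, m) l₁).2, z.2], fun i => ?_, ?_⟩
    · fin_cases i
      · exact (hu 0).hasDerivWithinAt
      · have h1 := hd1 0
        rw [sub_zero, S.eq_field _ (S.invariant hp hmR hmE h₁.le).1.le] at h1
        exact h1.hasDerivWithinAt
      · have h2 := hd2 0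
        rw [S.flow_zero, S.eq_field _ hzR.le] at h2
        exact h2.hasDerivWithinAt
    · rw [Fin.sum_univ_three]
      change w 0 + -(S.flow (0, m) l₁).2 + z.2 = 0
      rw [hw0, hz]
      simp only [NlsFlow.longEdgeData]
      ring
  · intro i
    fin_cases i
    · exact fun x _ => hu_nn x
    · change ∀ x ∈ G.edge 1, _
      rw [e1]
      exact fun x hx => hn1 (l₁ - x) ⟨by linarith [hx.2], by linarith [hx.1]⟩
    · change ∀ x ∈ G.edge 2, _
      rw [e2]
      exact hn2
  · rw [← hw0]
    exact hu 0

end StarMetricGraph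

theorem mainTheorem9 (p : ℝ) (hp : 2 < p) :
    ∃ a : ℝ, 0 < a ∧ ∃ L : ℝ, 0 < L ∧
      ∀ (ℓ₁ ℓ₂ : ℝ) (h₁ : 0 < ℓ₁) (h₂ : 0 < ℓ₂), ℓ₁ < a → L < ℓ₂ →
        ∃ v w : Fin 3 → ℝ → ℝ,
          (StarMetricGraph.halfLineTwoBounded ℓ₁ ℓ₂ h₁ h₂).IsKirkhoffODESolution p v ∧
          (StarMetricGraph.halfLineTwoBounded ℓ₁ ℓ₂ h₁ h₂).IsKirkhoffODESolution p w ∧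
          (StarMetricGraph.halfLineTwoBounded ℓ₁ ℓ₂ h₁ h₂).Nonneg v ∧
          (StarMetricGraph.halfLineTwoBounded ℓ₁ ℓ₂ h₁ h₂).Nonneg w ∧
          ¬ (StarMetricGraph.halfLineTwoBounded ℓ₁ ℓ₂ h₁ h₂).SameFun v 0 ∧
          ¬ (StarMetricGraph.halfLineTwoBounded ℓ₁ ℓ₂ h₁ h₂).SameFun w 0 ∧
          ¬ (StarMetricGraph.halfLineTwoBounded ℓ₁ ℓ₂ h₁ h₂).SameFun v w := by
  obtain ⟨a, ha, L, hL, H⟩ := StarMetricGraph.exists_solution_of_sign hp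
  refine ⟨a, ha, L, hL, fun ℓ₁ ℓ₂ h₁ h₂ hla hLl => ?_⟩
  obtain ⟨v, hv, hvn, hv0, d, hd, hvd⟩ := H ℓ₁ ℓ₂ h₁ h₂ hla hLl 1 (by norm_num)
  obtain ⟨w, hw, hwn, hw0, e, he, hwd⟩ := H ℓ₁ ℓ₂ h₁ h₂ hla hLl (-1) (by norm_num)
  have hedge : (StarMetricGraph.halfLineTwoBounded ℓ₁ ℓ₂ h₁ h₂).edge 0 = Set.Ici 0 :=
    (StarMetricGraph.edge_of_length_eq_top rfl).1
  have hmem : (0 : ℝ) ∈ (StarMetricGraph.halfLineTwoBounded ℓ₁ ℓ₂ h₁ h₂).edge 0 := by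
    rw [hedge]; exact Set.self_mem_Ici
  refine ⟨v, w, hv, hw, hvn, hwn, fun h => hv0.ne' (h 0 0 hmem), fun h => hw0.ne' (h 0 0 hmem),
    fun h => ?_⟩
  -- Equal functions would have equal one-sided slopes at the origin of the half-line, but these are
  -- $d>0$ and $-e<0$.
  have hvw : Set.EqOn (v 0) (w 0) (Set.Ici 0) := fun x hx => h 0 x (by rwa [hedge])
  have h1 := (uniqueDiffWithinAt_Ici (0 : ℝ)).eq_deriv _ hvd.hasDerivWithinAt
    (hwd.hasDerivWithinAt.congr hvw (hvw Set.self_mem_Ici))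
  linarith
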